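/- Let $D$ be an integral domain with quotient field $K$. A semistar operation on $D$ is a map $E\mapsto E^\star$ from the set of nonzero $D$-submodules of $K$ to itself such that, for all nonzero $x\in K$ and all nonzero $D$-submodules $E,F$ of $K$: $(xE)^\star=xE^\star$; $E\subseteq F$ implies $E^\star\subseteq F^\star$; $E\subseteq E^\star$ and $(E^\star)^\star=E^\star$. To $\star$ one associates the semistar operation $\star_f$ given by $E^{\star_f}=\bigcup\{F^\star : F\subseteq E,\ F \text{ a nonzero finitely generated } D\text{-submodule of } K\}$. A nonzero ideal $I$ of $D$ is a quasi-$\star_f$-ideal if $I=I^{\star_f}\cap D$, and a nonzero $D$-submodule $E$ of $K$ (in particular, a nonzero ideal of $D$) is $\star_f$-idempotent if $E^{\star_f}=(E^2)^{\star_f}$. The domain $D$ is a Prüfer $\star$-multiplication domain (P$\star$MD) if $(FF^{-1})^{\star_f}=D^{\star_f}$ for every nonzero finitely generated $D$-submodule $F$ of $K$, where $F^{-1}=\{u\in K : uF\subseteq D\}$. Let $\star$ be a semistar operation on $D$ such that $D$ is a P$\star$MD, and let $I$ be a quasi-$\star_f$-ideal of $D$. Then $I$ is $\star_f$-idempotent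 if and only if $I$ is a radical ideal each of whose minimal primes is $\star_f$-idempotent. In particular, let $E^v=(D:(D:E))$, where $(D:E)=\{u\in K : uE\subseteq D\}$, and let $t=v_f$. Suppose that $D$ is a P$v$MD, i.e. $(JJ^{-1})^t=D$ for every nonzero finitely generated ideal $J$ of $D$, and let $I$ be a $t$-ideal of $D$, i.e. a nonzero ideal with $I^t=I$. Then $I$ is $t$-idempotent (i.e. $I^t=(I^2)^t$) if and only if $I$ is a radical ideal each of whose minimal primes is $t$-idempotent. -/

import Mathlib

open scoped Pointwise

noncomputable section

/-- A semistar operation on a domain `D` with quotient field `K`: a closure operation `E ↦ E^⋆`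
on the nonzero `D`-submodules of `K` that commutes with multiplication by nonzero `x ∈ K`.
The map is written as a total function on submodules; all laws, and all notions below, concern
nonzero submodules only, so the value at `⊥` plays no role. Nonzero submodules go to nonzero ones
because `E ≤ E^⋆`. -/
structure SemistarOperation (D K : Type*) [CommRing D] [Field K] [Algebra D K] where
  toFun : Submodule D K → Submodule D K
  map_smul : ∀ (x : K), x ≠ 0 → ∀ E : Submodule D K, E ≠ ⊥ → toFun (x • E) = x • toFun E
  mono : ∀ E F : Submodule D K, E ≠ ⊥ → F ≠ ⊥ → E ≤ F → toFun E ≤ toFun F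
  le_map : ∀ E : Submodule D K, E ≠ ⊥ → E ≤ toFun E
  idem : ∀ E : Submodule D K, E ≠ ⊥ → toFun (toFun E) = toFun E

namespace SemistarOperation

variable {D K : Type*} [CommRing D] [Field K] [Algebra D K]

theorem smul_ne_bot {x : K} (hx : x ≠ 0) {E : Submodule D K} (hE : E ≠ ⊥) : x • E ≠ ⊥ := by
  obtain ⟨y, hy, hy0⟩ := E.ne_bot_iff.1 hE
  exact (Submodule.ne_bot_iff _).2
    ⟨x • y, Submodule.smul_mem_pointwise_smul y x E hy, mul_ne_zero hx hy0⟩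

theorem ne_bot_of_le {E F : Submodule D K} (h : E ≤ F) (hE : E ≠ ⊥) : F ≠ ⊥ := by
  rintro rfl
  exact hE (le_bot_iff.1 h)

/-- The supremum of all `F^⋆`, for `F ≤ E` nonzero and finitely generated.
For `E ≠ ⊥` this is the union of the `F^⋆`, see `mem_finiteTypeFun`. -/
def finiteTypeFun (star : SemistarOperation D K) (E : Submodule D K) : Submodule D K :=
  sSup {G | ∃ F : Submodule D K, F ≠ ⊥ ∧ F.FG ∧ F ≤ E ∧ G = star.toFun F}

theorem mem_finiteTypeFun (star : SemistarOperation D K) {E : Submodule D K} (hE : E ≠ ⊥) (x : K) :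
    x ∈ star.finiteTypeFun E ↔
      ∃ F : Submodule D K, F ≠ ⊥ ∧ F.FG ∧ F ≤ E ∧ x ∈ star.toFun F := by
  unfold finiteTypeFun
  rw [Submodule.mem_sSup_of_directed]
  · constructor
    · rintro ⟨_, ⟨F, h0, hfg, hle, rfl⟩, hx⟩
      exact ⟨F, h0, hfg, hle, hx⟩
    · rintro ⟨F, h0, hfg, hle, hx⟩
      exact ⟨_, ⟨F, h0, hfg, hle, rfl⟩, hx⟩
  · obtain ⟨y, hy, hy0⟩ := E.ne_bot_iff.1 hE
    exact ⟨_, Submodule.span D {y}, by simpa using hy0, Submodule.fg_span_singleton y,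
      by simpa using hy, rfl⟩
  · rintro _ ⟨F, h0, hfg, hle, rfl⟩ _ ⟨F', h0', hfg', hle', rfl⟩
    have hs : F ⊔ F' ≠ ⊥ := ne_bot_of_le le_sup_left h0
    exact ⟨_, ⟨F ⊔ F', hs, hfg.sup hfg', sup_le hle hle', rfl⟩,
      star.mono _ _ h0 hs le_sup_left, star.mono _ _ h0' hs le_sup_right⟩

theorem finiteTypeFun_mono (star : SemistarOperation D K) {E F : Submodule D K} (h : E ≤ F) :
    star.finiteTypeFun E ≤ star.finiteTypeFun F := by
  apply sSup_le_sSup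
  rintro _ ⟨G, h0, hfg, hle, rfl⟩
  exact ⟨G, h0, hfg, hle.trans h, rfl⟩

theorem le_finiteTypeFun (star : SemistarOperation D K) (E : Submodule D K) :
    E ≤ star.finiteTypeFun E := by
  intro y hy
  by_cases hy0 : y = 0
  · rw [hy0]
    exact zero_mem _
  · have h0 : Submodule.span D {y} ≠ ⊥ := by simpa using hy0
    have h1 : star.toFun (Submodule.span D {y}) ≤ star.finiteTypeFun E :=
      le_sSup ⟨_, h0, Submodule.fg_span_singleton y, by simpa using hy, rfl⟩
    exact h1 (star.le_map _ h0 (Submodule.mem_span_singleton_self y))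

theorem smul_finiteTypeFun_le (star : SemistarOperation D K) {x : K} (hx : x ≠ 0)
    {E : Submodule D K} (hE : E ≠ ⊥) :
    x • star.finiteTypeFun E ≤ star.finiteTypeFun (x • E) := by
  intro z hz
  obtain ⟨y, hy, rfl⟩ := Submodule.mem_smul_pointwise_iff_exists _ _ _ |>.1 hz
  obtain ⟨F, h0, hfg, hle, hyF⟩ := (star.mem_finiteTypeFun hE y).1 hy
  refine (star.mem_finiteTypeFun (smul_ne_bot hx hE) _).2
    ⟨x • F, smul_ne_bot hx h0, hfg.map _, Submodule.map_mono hle, ?_⟩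
  rw [star.map_smul x hx F h0]
  exact Submodule.smul_mem_pointwise_smul y x _ hyF

/-- The finite-type semistar operation `⋆_f` associated to `⋆`. -/
def finiteType (star : SemistarOperation D K) : SemistarOperation D K where
  toFun := star.finiteTypeFun
  map_smul := by
    intro x hx E hE
    refine le_antisymm ?_ (star.smul_finiteTypeFun_le hx hE)
    have h := star.smul_finiteTypeFun_le (inv_ne_zero hx) (smul_ne_bot hx hE)
    rw [smul_smul, inv_mul_cancel₀ hx, one_smul] at h
    intro z hz
    have hz' := h (Submodule.smul_mem_pointwise_smul z x⁻¹ _ hz)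
    have h2 := Submodule.smul_mem_pointwise_smul _ x _ hz'
    rwa [smul_smul, mul_inv_cancel₀ hx, one_smul] at h2
  mono := fun _ _ _ _ h => star.finiteTypeFun_mono h
  le_map := fun E _ => star.le_finiteTypeFun E
  idem := by
    intro E hE
    have hE' : star.finiteTypeFun E ≠ ⊥ := ne_bot_of_le (star.le_finiteTypeFun E) hE
    refine le_antisymm ?_ (star.le_finiteTypeFun _)
    intro x hx
    obtain ⟨F, h0, hfg, hle, hxF⟩ := (star.mem_finiteTypeFun hE' x).1 hx
    have key : ∀ G : Submodule D K, G.FG → G ≤ star.finiteTypeFun E →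
        ∃ H : Submodule D K, H ≠ ⊥ ∧ H.FG ∧ H ≤ E ∧ G ≤ star.toFun H := by
      intro G hG
      induction G, hG using Submodule.fg_induction with
      | singleton y =>
        intro hy
        obtain ⟨H, hH0, hHfg, hHle, hyH⟩ := (star.mem_finiteTypeFun hE y).1
          (hy (Submodule.mem_span_singleton_self y))
        exact ⟨H, hH0, hHfg, hHle, by simpa using hyH⟩
      | sup M₁ M₂ _ _ ih₁ ih₂ =>
        intro h
        obtain ⟨H₁, a0, afg, ale, aG⟩ := ih₁ (le_sup_left.trans h)
        obtain ⟨H₂, b0, bfg, ble, bG⟩ := ih₂ (le_sup_right.trans h)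
        have hs : H₁ ⊔ H₂ ≠ ⊥ := ne_bot_of_le le_sup_left a0
        exact ⟨H₁ ⊔ H₂, hs, afg.sup bfg, sup_le ale ble,
          sup_le (aG.trans (star.mono _ _ a0 hs le_sup_left))
            (bG.trans (star.mono _ _ b0 hs le_sup_right))⟩
    obtain ⟨H, hH0, hHfg, hHle, hFH⟩ := key F hfg hle
    refine (star.mem_finiteTypeFun hE x).2 ⟨H, hH0, hHfg, hHle, ?_⟩
    have h1 := star.mono _ _ h0 (ne_bot_of_le (star.le_map H hH0) hH0) hFH
    rw [star.idem H hH0] at h1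
    exact h1 hxF

/-- A nonzero submodule `E` of `K` is `⋆`-idempotent if `E^⋆ = (E²)^⋆`. -/
def IsIdempotent (star : SemistarOperation D K) (E : Submodule D K) : Prop :=
  E ≠ ⊥ ∧ star.toFun E = star.toFun (E ^ 2)

/-- An ideal `I` of `D` is `⋆`-idempotent if it is so as a `D`-submodule of `K`. -/
def IsIdempotentIdeal (star : SemistarOperation D K) (I : Ideal D) : Prop :=
  star.IsIdempotent (IsLocalization.coeSubmodule K I)

/-- A nonzero ideal `I` of `D` is a quasi-`⋆`-ideal if `I = I^⋆ ∩ D`. -/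
def IsQuasiIdeal (star : SemistarOperation D K) (I : Ideal D) : Prop :=
  I ≠ ⊥ ∧ I = (star.toFun (IsLocalization.coeSubmodule K I)).comap (Algebra.linearMap D K)

/-- `D` is a Prüfer `⋆`-multiplication domain: every nonzero finitely generated `D`-submodule `F`
of `K` satisfies `(F F⁻¹)^{⋆_f} = D^{⋆_f}`, where `F⁻¹ = (D : F)` is `1 / F`
(and `D`, as a submodule of `K`, is `1`). -/
def IsPStarMD (star : SemistarOperation D K) : Prop :=
  ∀ F : Submodule D K, F ≠ ⊥ → F.FG →
    star.finiteType.toFun (F * (1 / F)) = star.finiteType.toFun 1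

end SemistarOperation

section VOperation

variable (D K : Type*) [CommRing D] [Field K] [Algebra D K]

/-- `E ↦ (D : (D : E))`, which is `K` when `(D : E) = 0`. -/
def SemistarOperation.v : SemistarOperation D K where
  toFun E := 1 / (1 / E)
  map_smul := by
    intro x hx E _
    ext z
    rw [Submodule.mem_smul_pointwise_iff_exists]
    simp only [Submodule.mem_div_iff_forall_mul_mem, smul_eq_mul]
    constructor
    · intro h
      refine ⟨x⁻¹ * z, fun y hy => ?_, by field_simp⟩
      have := h (x⁻¹ * y) (fun w hw => ?_)
      · convert this using 1
        ring
      · obtain ⟨e, he, rfl⟩ := (Submodule.mem_smul_pointwise_iff_exists _ _ _).1 hw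
        have h2 := hy e he
        convert h2 using 1
        simp only [smul_eq_mul]
        field_simp
    · rintro ⟨u, hu, rfl⟩ y hy
      have := hu (x * y) (fun e he => by
        have h2 := hy (x • e) (Submodule.smul_mem_pointwise_smul e x E he)
        convert h2 using 1
        simp only [smul_eq_mul]
        ring)
      convert this using 1
      ring
  mono := by
    intro E F _ _ h z hz
    rw [Submodule.mem_div_iff_forall_mul_mem] at hz ⊢
    intro y hy
    rw [Submodule.mem_div_iff_forall_mul_mem] at hy
    exact hz y (Submodule.mem_div_iff_forall_mul_mem.2 fun w hw => hy w (h hw))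
  le_map := by
    intro E _ z hz
    rw [Submodule.mem_div_iff_forall_mul_mem]
    intro y hy
    rw [mul_comm]
    exact Submodule.mem_div_iff_forall_mul_mem.1 hy z hz
  idem := by
    intro E _
    ext z
    simp only [Submodule.mem_div_iff_forall_mul_mem]
    constructor
    · intro h y hy
      refine h y fun w hw => ?_
      rw [mul_comm]
      exact hw y hy
    · intro h y hy
      refine h y fun w hw => hy w fun u hu => ?_
      rw [mul_comm]
      exact hu w hw

/-- The `t`-operation `v_f`. -/
def SemistarOperation.t : SemistarOperation D K := (SemistarOperation.v D K).finiteType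

/-- `I` is a `t`-ideal: a nonzero ideal with `I^t = I`. -/
def IsTIdeal (I : Ideal D) : Prop :=
  I ≠ ⊥ ∧ (SemistarOperation.t D K).toFun (IsLocalization.coeSubmodule K I) =
    IsLocalization.coeSubmodule K I

/-- `D` is a P`v`MD: every nonzero finitely generated ideal `J` of `D` is `t`-invertible, that is,
`(J J⁻¹)^t = D`. -/
def IsPvMD : Prop :=
  ∀ J : Ideal D, J ≠ ⊥ → J.FG →
    (SemistarOperation.t D K).toFun
      (IsLocalization.coeSubmodule K J * (1 / IsLocalization.coeSubmodule K J)) = 1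

end VOperation

end

/-! The statement reduces to one about valuation domains. Call an ideal `J` dense if `1 ∈ J^{⋆_f}`.
Every non-dense ideal lies in a non-dense prime, and in a P⋆MD an element `x` of `D` lies in
`I^{⋆_f}` exactly when `x ∈ I D_M` for all non-dense primes `M`
(`mem_finiteTypeFun_of_forall_prime`, `InvertsFGIdeals.exists_notMem_mul_mem`). Moreover each such
`D_M` is a valuation domain (`InvertsFGIdeals.isLocallyValuationAt`).

In a valuation domain, `x² ∈ I²` forces `x ∈ I`; so if `I = I²` locally, then `x² ∈ I` gives `x ∈
I`, and `I` is radical. Conversely, a radical ideal `I` and a minimal prime `P ⊆ M` of `I` have the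
same localization at `M`, so idempotence passes between `I` and `P`.

Both halves of the theorem need only `InvertsFGIdeals`, a common consequence of the P⋆MD and the
P`v`MD conditions. Localizations appear through denominators: `∃ t ∉ M, t * x ∈ I` stands for `x ∈ I
D_M`. -/

open IsLocalization (coeSubmodule)

/-! ### Ideals in a localization at a prime, in terms of denominators. -/

namespace Ideal

variable {R : Type*} [CommRing R]

/-- Local membership at a prime ideal can be checked on generators of a product of ideals. -/
theorem exists_notMem_mul_mem_of_mem_mul {A B C M : Ideal R} (hM : M.IsPrime)
    (h : ∀ a ∈ A, ∀ b ∈ B, ∃ t ∉ M, t * (a * b) ∈ C) {y : R} (hy : y ∈ A * B) :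
    ∃ t ∉ M, t * y ∈ C := by
  induction hy using Submodule.mul_induction_on' with
  | mem_mul_mem a ha b hb => exact h a ha b hb
  | add x _ y _ hx hy =>
    obtain ⟨s, hs, hsx⟩ := hx
    obtain ⟨t, ht, hty⟩ := hy
    refine ⟨s * t, fun h => (hM.mem_or_mem h).elim hs ht, ?_⟩
    have : s * t * (x + y) = t * (s * x) + s * (t * y) := by ring
    rw [this]
    exact C.add_mem (C.mul_mem_left _ hsx) (C.mul_mem_left _ hty)

/-- The localization of a radical ideal at a minimal prime is the maximal ideal. -/
theorem IsRadical.exists_notMem_mul_mem {I P : Ideal R} (hI : I.IsRadical)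
    (hP : P ∈ I.minimalPrimes) {x : R} (hx : x ∈ P) : ∃ s ∉ P, s * x ∈ I := by
  have hPp : P.IsPrime := hP.1.1
  by_contra! hcon
  -- A prime over `I` avoiding all products `s * x ^ n` with `s ∉ P` would lie in `P` and miss `x`,
  -- against the minimality of `P`.
  have hdisj : Disjoint (I : Set R) (P.primeCompl ⊔ Submonoid.powers x : Submonoid R) := by
    rw [Set.disjoint_left]
    intro z hzI hz
    obtain ⟨s, hs, _, ⟨n, rfl⟩, rfl⟩ := Submonoid.mem_sup.1 hz
    refine hcon s hs (hI ⟨n + 1, ?_⟩)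
    have : (s * x) ^ (n + 1) = s * x ^ n * (s ^ n * x) := by ring
    rw [this]
    exact I.mul_mem_right _ hzI
  obtain ⟨Q, hQ, hIQ, hQd⟩ := Ideal.exists_le_prime_disjoint I _ hdisj
  rw [Set.disjoint_left] at hQd
  have hQP : Q ≤ P := by
    intro z hz
    by_contra hzP
    exact hQd hz (Submonoid.mem_sup_left hzP)
  exact hQd (hP.2 ⟨hQ, hIQ⟩ hQP hx) (Submonoid.mem_sup_right (Submonoid.mem_powers x))

/-- `R` localized at the ideal `M` has totally ordered divisibility. -/
def IsLocallyValuationAt (M : Ideal R) : Prop :=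
  ∀ a b : R, ∃ t ∉ M, ∃ d, t * b = d * a ∨ t * a = d * b

/-- If the localization at `M` is a valuation ring, a radical ideal and a minimal prime over it
contained in `M` have the same localization at `M`. -/
theorem IsLocallyValuationAt.exists_notMem_mul_mem {M I P : Ideal R}
    (hval : M.IsLocallyValuationAt) (hI : I.IsRadical) (hP : P ∈ I.minimalPrimes) (hPM : P ≤ M)
    {x : R} (hx : x ∈ P) : ∃ t ∉ M, t * x ∈ I := by
  have hPp : P.IsPrime := hP.1.1
  obtain ⟨s, hs, hsx⟩ := hI.exists_notMem_mul_mem hP hx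
  -- If `s` divides `x` locally, the square of `t * x` is a multiple of `s * x ∈ I`. If `x` divides
  -- `s` locally, then `t * s ∈ P`, although neither factor is in `P`.
  obtain ⟨t, ht, d, h | h⟩ := hval s x
  · refine ⟨t, ht, hI ⟨2, ?_⟩⟩
    have : (t * x) ^ 2 = (d * t) * (s * x) := by
      rw [sq]; nth_rewrite 1 [h]; ring
    rw [this]
    exact I.mul_mem_left _ hsx
  · have hts : t * s ∈ P := h ▸ P.mul_mem_left d hx
    exact ((hPp.mem_or_mem hts).elim (fun h => ht (hPM h)) hs).elim

/-- In a valuation ring, `x ^ 2` in the square of an ideal `I` forces `x` in `I`. -/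
theorem IsLocallyValuationAt.exists_notMem_mul_mem_of_sq {M I : Ideal R} [IsDomain R]
    (hM : M.IsPrime) (hval : M.IsLocallyValuationAt) {x s : R} (hs : s ∉ M)
    (hx : s * x ^ 2 ∈ I * I) : ∃ t ∉ M, t * x ∈ I := by
  by_contra! hcon
  have hx0 : x ≠ 0 := by
    rintro rfl
    exact hcon 1 ((Ideal.ne_top_iff_one M).1 hM.ne_top) (by simp)
  -- Since `x` is not in `I` locally, every `a ∈ I` is locally a multiple of `x`, with a coefficient
  -- that is not a unit at `M`. Hence `I * I` is locally inside `M * x ^ 2`.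
  have hdiv : ∀ a ∈ I, ∃ t ∉ M, ∃ d ∈ M, t * a = d * x := by
    intro a ha
    obtain ⟨t, ht, d, h | h⟩ := hval a x
    · exact (hcon t ht (h ▸ I.mul_mem_left d ha)).elim
    · refine ⟨t, ht, d, ?_, h⟩
      by_contra hd
      exact hcon d hd (h ▸ I.mul_mem_left t ha)
  obtain ⟨t, ht, htx⟩ := Ideal.exists_notMem_mul_mem_of_mem_mul (C := M * Ideal.span {x ^ 2}) hM
    (fun a ha b hb => by
      obtain ⟨t, ht, d, hd, h⟩ := hdiv a ha
      obtain ⟨t', ht', d', -, h'⟩ := hdiv b hb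
      refine ⟨t * t', fun h => (hM.mem_or_mem h).elim ht ht', ?_⟩
      have : t * t' * (a * b) = (d * d') * x ^ 2 := by
        linear_combination t' * b * h + d * x * h'
      rw [this]
      exact Ideal.mul_mem_mul (M.mul_mem_right _ hd) (Ideal.mem_span_singleton_self _)) hx
  -- Cancelling `x ^ 2` leaves `t * s ∈ M`, with both factors outside `M`.
  obtain ⟨m, hm, h⟩ := Ideal.mem_mul_span_singleton.1 htx
  rw [← mul_assoc] at h
  rw [mul_right_cancel₀ (pow_ne_zero 2 hx0) h] at hm
  exact (hM.mem_or_mem hm).elim ht hs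

end Ideal

/-! ### The closure `⋆_f` and its dense ideals. -/

namespace SemistarOperation

section Closure

variable {D K : Type*} [CommRing D] [Field K] [Algebra D K] (star : SemistarOperation D K)

/-- The supremum runs over nonzero `F`, so here it is empty. This lets the laws below include `⊥`.
-/
theorem finiteTypeFun_bot : star.finiteTypeFun (⊥ : Submodule D K) = ⊥ := by
  refine sSup_eq_bot.2 ?_
  rintro _ ⟨F, h0, -, hle, rfl⟩
  exact (h0 (le_bot_iff.1 hle)).elim

theorem finiteTypeFun_idem (E : Submodule D K) :
    star.finiteTypeFun (star.finiteTypeFun E) = star.finiteTypeFun E := by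
  rcases eq_or_ne E ⊥ with rfl | hE
  · rw [finiteTypeFun_bot, finiteTypeFun_bot]
  · exact star.finiteType.idem E hE

/-- Compatibility with scaling suffices: for nonzero `y ∈ F`, `y E^{⋆_f} ⊆ (yE)^{⋆_f} ⊆ (EF)^{⋆_f}`.
-/
theorem finiteTypeFun_mul_le (E F : Submodule D K) :
    star.finiteTypeFun E * F ≤ star.finiteTypeFun (E * F) := by
  rw [Submodule.mul_le]
  intro x hx y hy
  rcases eq_or_ne y 0 with rfl | hy0
  · simp
  rcases eq_or_ne E ⊥ with rfl | hE
  · have : x = 0 := by simpa [finiteTypeFun_bot] using hx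
    simp [this]
  have h1 : y • x ∈ star.finiteTypeFun (y • E) :=
    star.smul_finiteTypeFun_le hy0 hE (Submodule.smul_mem_pointwise_smul x y _ hx)
  have h2 : y • E ≤ E * F := by
    intro z hz
    obtain ⟨e, he, rfl⟩ := (Submodule.mem_smul_pointwise_iff_exists _ _ _).1 hz
    rw [smul_eq_mul, mul_comm y]
    exact Submodule.mul_mem_mul he hy
  rw [mul_comm x]
  exact star.finiteTypeFun_mono h2 h1

theorem finiteTypeFun_mul_finiteTypeFun_le (E F : Submodule D K) :
    star.finiteTypeFun E * star.finiteTypeFun F ≤ star.finiteTypeFun (E * F) := by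
  refine (star.finiteTypeFun_mul_le E _).trans ?_
  rw [← star.finiteTypeFun_idem (E * F), mul_comm E, mul_comm E]
  exact star.finiteTypeFun_mono (star.finiteTypeFun_mul_le F E)

/-- The ideals `J` with `1 ∈ J^{⋆_f}`, that is, `J^{⋆_f} = D^{⋆_f}`. -/
def IsDenseIdeal (J : Ideal D) : Prop :=
  (1 : K) ∈ star.finiteTypeFun (coeSubmodule K J)

variable {star}

theorem IsDenseIdeal.mono {J J' : Ideal D} (h : J ≤ J') (hJ : star.IsDenseIdeal J) :
    star.IsDenseIdeal J' :=
  star.finiteTypeFun_mono (IsLocalization.coeSubmodule_mono K h) hJ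

theorem isDenseIdeal_top : star.IsDenseIdeal ⊤ :=
  star.le_finiteTypeFun _ (by rw [IsLocalization.coeSubmodule_top]; exact Submodule.one_le.1 le_rfl)

theorem IsDenseIdeal.mul {J J' : Ideal D} (hJ : star.IsDenseIdeal J) (hJ' : star.IsDenseIdeal J') :
    star.IsDenseIdeal (J * J') := by
  have h := star.finiteTypeFun_mul_finiteTypeFun_le _ _ (Submodule.mul_mem_mul hJ hJ')
  rw [one_mul, ← IsLocalization.coeSubmodule_mul] at h
  exact h

theorem IsDenseIdeal.exists_notMem {J M : Ideal D} (hJ : star.IsDenseIdeal J)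
    (hM : ¬ star.IsDenseIdeal M) : ∃ j ∈ J, j ∉ M :=
  Set.not_subset.1 fun h => hM (hJ.mono h)

theorem exists_coeSubmodule_eq {E : Submodule D K} (h : E ≤ 1) :
    ∃ J : Ideal D, coeSubmodule K J = E :=
  ⟨E.comap (Algebra.linearMap D K), Submodule.map_comap_eq_self (by
    rwa [← Submodule.one_eq_range])⟩

theorem IsDenseIdeal.ne_bot {J : Ideal D} (hJ : star.IsDenseIdeal J) : J ≠ ⊥ := by
  rintro rfl
  rw [IsDenseIdeal, IsLocalization.coeSubmodule_bot, finiteTypeFun_bot] at hJ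
  exact one_ne_zero ((Submodule.mem_bot D).1 hJ)

/-- Multiply `1 ∈ J^{⋆_f}` by `x`: `x ∈ (Jx)^{⋆_f} ⊆ I^{⋆_f}`. -/
theorem IsDenseIdeal.mem_finiteTypeFun {J I : Ideal D} (hJ : star.IsDenseIdeal J) {x : D}
    (h : ∀ j ∈ J, j * x ∈ I) : algebraMap D K x ∈ star.finiteTypeFun (coeSubmodule K I) := by
  have h1 := star.finiteTypeFun_mul_le _ _ (Submodule.mul_mem_mul hJ
    (Submodule.mem_span_singleton_self (R := D) (algebraMap D K x)))
  rw [one_mul] at h1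
  refine star.finiteTypeFun_mono ?_ h1
  rw [← IsLocalization.coeSubmodule_span_singleton, ← IsLocalization.coeSubmodule_mul]
  refine IsLocalization.coeSubmodule_mono K fun y hy => ?_
  obtain ⟨j, hj, rfl⟩ := Ideal.mem_mul_span_singleton.1 hy
  exact h j hj

end Closure

/-! ### Non-dense primes and the local description of `⋆_f`. -/

variable {D K : Type*} [CommRing D] [Field K] [Algebra D K] [IsFractionRing D K]
  {star : SemistarOperation D K}

theorem coeSubmodule_ne_bot {I : Ideal D} (hI : I ≠ ⊥) : coeSubmodule K I ≠ ⊥ := fun h =>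
  hI (IsFractionRing.coeSubmodule_injective D K (h.trans (IsLocalization.coeSubmodule_bot K).symm))

theorem algebraMap_mem_coeSubmodule {I : Ideal D} {x : D} :
    algebraMap D K x ∈ coeSubmodule K I ↔ x ∈ I := by
  rw [IsLocalization.mem_coeSubmodule]
  constructor
  · rintro ⟨y, hy, h⟩
    rwa [← IsFractionRing.injective D K h]
  · exact fun h => ⟨x, h, rfl⟩

theorem exists_fg_of_mem_finiteTypeFun {I : Ideal D} (hI : I ≠ ⊥) {x : K}
    (hx : x ∈ star.finiteTypeFun (coeSubmodule K I)) :
    ∃ J : Ideal D, J ≠ ⊥ ∧ J.FG ∧ J ≤ I ∧ x ∈ star.finiteTypeFun (coeSubmodule K J) := by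
  obtain ⟨F, h0, hfg, hle, hx⟩ := (star.mem_finiteTypeFun (coeSubmodule_ne_bot hI) x).1 hx
  have hF1 : F ≤ 1 := hle.trans (by
    rw [← IsLocalization.coeSubmodule_top K]
    exact IsLocalization.coeSubmodule_mono K le_top)
  obtain ⟨J, rfl⟩ := exists_coeSubmodule_eq hF1
  refine ⟨J, ?_, (IsLocalization.coeSubmodule_fg K (IsFractionRing.injective D K) J).1 hfg,
    IsFractionRing.coeSubmodule_le_coeSubmodule.1 hle,
    (star.mem_finiteTypeFun h0 x).2 ⟨_, h0, hfg, le_rfl, hx⟩⟩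
  rintro rfl
  exact h0 (IsLocalization.coeSubmodule_bot K)

theorem exists_isPrime_not_isDenseIdeal {A : Ideal D} (hA : ¬ star.IsDenseIdeal A) :
    ∃ M : Ideal D, A ≤ M ∧ M.IsPrime ∧ ¬ star.IsDenseIdeal M := by
  obtain ⟨M, hAM, hM⟩ := zorn_le_nonempty₀ {J : Ideal D | ¬ star.IsDenseIdeal J} (by
    intro c hc hchain y hy
    refine ⟨sSup c, fun hd => ?_, fun z hz => le_sSup hz⟩
    -- A dense union would contain a finitely generated dense ideal, which by compactness already
    -- lies in a member of the chain.
    obtain ⟨J, -, hfg, hle, hJ⟩ := exists_fg_of_mem_finiteTypeFun hd.ne_bot hd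
    obtain ⟨z, hz, hJz⟩ := (CompleteLattice.isCompactElement_iff_le_of_directed_sSup_le _ _).1
      ((Submodule.fg_iff_compact J).1 hfg) c ⟨y, hy⟩ hchain.directedOn hle
    exact hc hz (IsDenseIdeal.mono hJz hJ)) A hA
  refine ⟨M, hAM, ⟨?_, ?_⟩, hM.1⟩
  · rintro rfl
    exact hM.1 isDenseIdeal_top
  · intro a b hab
    by_contra! hcon
    -- By maximality, adjoining any new element to `M` gives a dense ideal. If `a * b ∈ M`, the
    -- product of two such dense ideals is dense and lies in `M`.
    have hd : ∀ a ∉ M, star.IsDenseIdeal (M ⊔ Ideal.span {a}) := by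
      intro a ha
      by_contra h
      exact ha (hM.2 h le_sup_left (Ideal.mem_sup_right (Ideal.mem_span_singleton_self a)))
    refine hM.1 (((hd a hcon.1).mul (hd b hcon.2)).mono ?_)
    rw [Ideal.sup_mul, Ideal.mul_sup, Ideal.mul_sup, Ideal.span_singleton_mul_span_singleton]
    exact sup_le (sup_le Ideal.mul_le_left Ideal.mul_le_left)
      (sup_le Ideal.mul_le_right ((Ideal.span_singleton_le_iff_mem _).2 hab))

variable (star) in
/-- Every nonzero finitely generated ideal `J` satisfies `1 ∈ (J J⁻¹)^{⋆_f}`. -/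
def InvertsFGIdeals : Prop :=
  ∀ J : Ideal D, J ≠ ⊥ → J.FG →
    (1 : K) ∈ star.finiteTypeFun (coeSubmodule K J * (1 / coeSubmodule K J))

/-- In a Prüfer `⋆`-multiplication domain, `⋆_f` is the closure defined by the dense ideals. -/
theorem InvertsFGIdeals.exists_isDenseIdeal (hinv : star.InvertsFGIdeals) {I : Ideal D}
    (hI : I ≠ ⊥) {x : D} (hx : algebraMap D K x ∈ star.finiteTypeFun (coeSubmodule K I)) :
    ∃ J : Ideal D, star.IsDenseIdeal J ∧ ∀ j ∈ J, j * x ∈ I := by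
  obtain ⟨A, hA0, hAfg, hAI, hxA⟩ := exists_fg_of_mem_finiteTypeFun hI hx
  -- The witness is `J = A G⁻¹`. As `G ⊆ A^{⋆_f}`, the closure of `J` contains `G G⁻¹`, so `J` is
  -- dense; and `J x ⊆ A G⁻¹ G ⊆ A`.
  set G : Ideal D := A ⊔ Ideal.span {x} with hG
  have hG1 := hinv G (ne_bot_of_le_ne_bot hA0 le_sup_left)
    (Submodule.FG.sup hAfg (Submodule.fg_span_singleton x))
  have hxG : algebraMap D K x ∈ coeSubmodule K G :=
    algebraMap_mem_coeSubmodule.2 (Ideal.mem_sup_right (Ideal.mem_span_singleton_self x))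
  have hGA : coeSubmodule K G ≤ star.finiteTypeFun (coeSubmodule K A) := by
    rw [hG, IsLocalization.coeSubmodule_sup, IsLocalization.coeSubmodule_span_singleton]
    exact sup_le (star.le_finiteTypeFun _) ((Submodule.span_singleton_le_iff_mem _ _).2 hxA)
  have hle : coeSubmodule K A * (1 / coeSubmodule K G) ≤ 1 :=
    (mul_le_mul_left (IsLocalization.coeSubmodule_mono K le_sup_left) _).trans
      Submodule.mul_one_div_le_one
  obtain ⟨J, hJ⟩ := exists_coeSubmodule_eq hle
  refine ⟨J, ?_, fun j hj => ?_⟩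
  · have h : coeSubmodule K G * (1 / coeSubmodule K G) ≤
        star.finiteTypeFun (coeSubmodule K A * (1 / coeSubmodule K G)) :=
      (mul_le_mul_left hGA _).trans (star.finiteTypeFun_mul_le _ _)
    have h' := star.finiteTypeFun_mono h hG1
    rwa [star.finiteTypeFun_idem, ← hJ] at h'
  · refine hAI (algebraMap_mem_coeSubmodule (K := K).1 ?_)
    have hj' : algebraMap D K j ∈ coeSubmodule K A * (1 / coeSubmodule K G) :=
      hJ ▸ algebraMap_mem_coeSubmodule.2 hj
    have h := Submodule.mul_mem_mul hj' hxG
    rw [mul_assoc, mul_comm (1 / coeSubmodule K G)] at h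
    rw [map_mul]
    exact (mul_le_mul_right Submodule.mul_one_div_le_one _).trans (mul_one _).le h

/-- Membership in `I^{⋆_f}` is implied by membership in all localizations of `I` at primes that are
not dense. -/
theorem mem_finiteTypeFun_of_forall_prime {I : Ideal D} {x : D}
    (h : ∀ M : Ideal D, M.IsPrime → ¬ star.IsDenseIdeal M → (∀ t ∉ M, t * x ∉ I) → False) :
    algebraMap D K x ∈ star.finiteTypeFun (coeSubmodule K I) := by
  -- This comap is the colon ideal `(I : x)`; a prime `M` contains it exactly when `x ∉ I D_M`.
  by_cases hd : star.IsDenseIdeal (Submodule.comap (LinearMap.mulRight D x) I)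
  · exact hd.mem_finiteTypeFun fun j hj => hj
  · obtain ⟨M, hle, hM, hMd⟩ := exists_isPrime_not_isDenseIdeal hd
    exact (h M hM hMd fun t ht htx => ht (hle htx)).elim

/-- Converse of `mem_finiteTypeFun_of_forall_prime`, and the half that needs invertibility: a dense
ideal carrying `x` into `I` is not inside `M`, so it contains a denominator. -/
theorem InvertsFGIdeals.exists_notMem_mul_mem (hinv : star.InvertsFGIdeals) {I M : Ideal D}
    (hI : I ≠ ⊥) (hM : ¬ star.IsDenseIdeal M) {x : D}
    (hx : algebraMap D K x ∈ star.finiteTypeFun (coeSubmodule K I)) : ∃ t ∉ M, t * x ∈ I := by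
  obtain ⟨J, hJ, h⟩ := hinv.exists_isDenseIdeal hI hx
  obtain ⟨t, htJ, ht⟩ := hJ.exists_notMem hM
  exact ⟨t, ht, h t htJ⟩

/-- For `u ∈ (a, b)⁻¹` put `p = ua`, `q = ub`, so that `p b = q a`. If `a` and `b` were incomparable
at `M`, both `p` and `q` would lie in `M`; then `(a, b)(a, b)⁻¹ ⊆ M` and `M` would be dense. -/
theorem InvertsFGIdeals.isLocallyValuationAt (hinv : star.InvertsFGIdeals) {M : Ideal D}
    (hM : ¬ star.IsDenseIdeal M) : M.IsLocallyValuationAt := by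
  intro a b
  have h1M : (1 : D) ∉ M := fun h =>
    hM (by rw [(Ideal.eq_top_iff_one M).2 h]; exact isDenseIdeal_top)
  rcases eq_or_ne a 0 with rfl | ha
  · exact ⟨1, h1M, 0, Or.inr (by simp)⟩
  have hG1 := hinv (Ideal.span {a, b}) (fun h => ha (by
      simpa [h] using Ideal.subset_span (s := {a, b}) (Set.mem_insert a {b})))
    (Submodule.fg_span (Set.toFinite _))
  set G := coeSubmodule K (Ideal.span {a, b}) with hG
  by_contra! hcon
  refine hM (star.finiteTypeFun_mono ?_ hG1)
  have haG : algebraMap D K a ∈ G :=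
    algebraMap_mem_coeSubmodule.2 (Ideal.subset_span (Set.mem_insert a {b}))
  have hbG : algebraMap D K b ∈ G :=
    algebraMap_mem_coeSubmodule.2 (Ideal.subset_span (Set.mem_insert_of_mem a rfl))
  rw [Submodule.mul_le]
  intro m hm u hu
  rw [Submodule.mem_div_iff_forall_mul_mem] at hu
  obtain ⟨p, hp⟩ := Submodule.mem_one.1 (hu _ haG)
  obtain ⟨q, hq⟩ := Submodule.mem_one.1 (hu _ hbG)
  have hpq : p * b = q * a := IsFractionRing.injective D K (by
    rw [map_mul, map_mul, hp, hq]; ring)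
  have hpM : p ∈ M := by
    by_contra h
    exact (hcon p h q).1 hpq
  have hqM : q ∈ M := by
    by_contra h
    exact (hcon q h p).2 hpq.symm
  obtain ⟨y, hy, rfl⟩ := (IsLocalization.mem_coeSubmodule K _).1 hm
  obtain ⟨c, d, rfl⟩ := Ideal.mem_span_pair.1 hy
  have : algebraMap D K (c * a + d * b) * u = algebraMap D K (c * p + d * q) := by
    simp only [map_add, map_mul, hp, hq]; ring
  rw [this]
  exact algebraMap_mem_coeSubmodule.2 (M.add_mem (M.mul_mem_left _ hpM) (M.mul_mem_left _ hqM))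

/-! ### Idempotence, compared locally. -/

theorem isIdempotentIdeal_iff {I : Ideal D} (hI : I ≠ ⊥) :
    star.finiteType.IsIdempotentIdeal I ↔
      ∀ x ∈ I, algebraMap D K x ∈ star.finiteTypeFun (coeSubmodule K (I * I)) := by
  have hsq : coeSubmodule K I ^ 2 = coeSubmodule K (I * I) := by
    rw [IsLocalization.coeSubmodule_mul, sq]
  unfold IsIdempotentIdeal IsIdempotent
  rw [hsq]
  change _ ∧ star.finiteTypeFun _ = star.finiteTypeFun _ ↔ _
  constructor
  · rintro ⟨-, h⟩ x hx
    rw [← h]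
    exact star.le_finiteTypeFun _ (algebraMap_mem_coeSubmodule.2 hx)
  · intro h
    refine ⟨coeSubmodule_ne_bot hI, le_antisymm ?_
      (star.finiteTypeFun_mono (IsLocalization.coeSubmodule_mono K Ideal.mul_le_left))⟩
    rw [← star.finiteTypeFun_idem (coeSubmodule K (I * I))]
    refine star.finiteTypeFun_mono ?_
    rintro _ ⟨x, hx, rfl⟩
    exact h x hx

theorem InvertsFGIdeals.isIdempotentIdeal_iff_isRadical [IsDomain D] (hinv : star.InvertsFGIdeals)
    {I : Ideal D} (hI : star.finiteType.IsQuasiIdeal I) :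
    star.finiteType.IsIdempotentIdeal I ↔
      I.IsRadical ∧ ∀ P ∈ I.minimalPrimes, star.finiteType.IsIdempotentIdeal P := by
  obtain ⟨hI0, hIq⟩ := hI
  have hmul {P : Ideal D} (hP : P ≠ ⊥) : P * P ≠ ⊥ := mul_ne_zero hP hP
  have hP0 : ∀ P ∈ I.minimalPrimes, P ≠ ⊥ := fun P hP => ne_bot_of_le_ne_bot hI0 hP.1.2
  rw [isIdempotentIdeal_iff hI0]
  constructor
  · intro hid
    have hrad : I.IsRadical := by
      rw [Ideal.isRadical_iff_pow_one_lt 2 one_lt_two]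
      intro x hx
      -- Being a quasi-ideal matters only here: it reduces membership in `I` to membership in
      -- `I^{⋆_f}`, which is local.
      rw [hIq]
      refine mem_finiteTypeFun_of_forall_prime fun M hM hMd hcon => ?_
      obtain ⟨s, hs, hsx⟩ := hinv.exists_notMem_mul_mem (hmul hI0) hMd (hid _ hx)
      obtain ⟨t, ht, htx⟩ :=
        (hinv.isLocallyValuationAt hMd).exists_notMem_mul_mem_of_sq hM hs hsx
      exact hcon t ht htx
    refine ⟨hrad, fun P hP => (isIdempotentIdeal_iff (hP0 P hP)).2 fun x hx => ?_⟩
    refine mem_finiteTypeFun_of_forall_prime fun M hM hMd hcon => ?_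
    -- An element of `P` outside `M` would be a denominator putting `x` in `P * P`, so only primes
    -- `M` containing `P` matter.
    have hPM : P ≤ M := fun t ht => by
      by_contra h
      exact hcon t h (Ideal.mul_mem_mul ht hx)
    obtain ⟨t, ht, htx⟩ :=
      (hinv.isLocallyValuationAt hMd).exists_notMem_mul_mem hrad hP hPM hx
    obtain ⟨s, hs, hsx⟩ := hinv.exists_notMem_mul_mem (hmul hI0) hMd (hid _ htx)
    refine hcon (s * t) (fun h => (hM.mem_or_mem h).elim hs ht) ?_
    rw [mul_assoc]
    exact Ideal.mul_mono hP.1.2 hP.1.2 hsx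
  · rintro ⟨hrad, hmin⟩ x hx
    refine mem_finiteTypeFun_of_forall_prime fun M hM hMd hcon => ?_
    have hIM : I ≤ M := fun t ht => by
      by_contra h
      exact hcon t h (Ideal.mul_mem_mul ht hx)
    -- At `M` this `P` agrees with `I`, so `P * P` agrees with `I * I`, and the idempotence of `P`
    -- transfers to `I`.
    obtain ⟨P, hP, hPM⟩ := Ideal.exists_minimalPrimes_le hIM
    have hloc := fun {y : D} => (hinv.isLocallyValuationAt hMd).exists_notMem_mul_mem hrad hP hPM
      (x := y)
    obtain ⟨s, hs, hsx⟩ := hinv.exists_notMem_mul_mem (hmul (hP0 P hP)) hMd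
      ((isIdempotentIdeal_iff (hP0 P hP)).1 (hmin P hP) x (hP.1.2 hx))
    obtain ⟨t, ht, htx⟩ := Ideal.exists_notMem_mul_mem_of_mem_mul (C := I * I) hM
      (fun a ha b hb => by
        obtain ⟨t, ht, hta⟩ := hloc ha
        obtain ⟨t', ht', htb⟩ := hloc hb
        refine ⟨t * t', fun h => (hM.mem_or_mem h).elim ht ht', ?_⟩
        rw [mul_mul_mul_comm]
        exact Ideal.mul_mem_mul hta htb) hsx
    refine hcon (t * s) (fun h => (hM.mem_or_mem h).elim ht hs) ?_
    rwa [mul_assoc]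

theorem IsPStarMD.invertsFGIdeals (h : star.IsPStarMD) : star.InvertsFGIdeals := by
  intro J hJ hfg
  have h1 := h _ (coeSubmodule_ne_bot hJ)
    ((IsLocalization.coeSubmodule_fg K (IsFractionRing.injective D K) J).2 hfg)
  change star.finiteTypeFun _ = star.finiteTypeFun _ at h1
  rw [h1]
  exact star.le_finiteTypeFun _ (Submodule.one_le.1 le_rfl)

end SemistarOperation

/-! ### The `t`-operation and the final statement. -/

theorem IsPvMD.invertsFGIdeals {D K : Type*} [CommRing D] [Field K]
    [Algebra D K] (h : IsPvMD D K) :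
    (SemistarOperation.v D K).InvertsFGIdeals := by
  intro J hJ hfg
  have h1 := h J hJ hfg
  change (SemistarOperation.v D K).finiteTypeFun _ = 1 at h1
  rw [h1]
  exact Submodule.one_le.1 le_rfl

theorem IsTIdeal.isQuasiIdeal {D K : Type*} [CommRing D] [Field K] [Algebra D K]
    [IsFractionRing D K] {I : Ideal D} (h : IsTIdeal D K I) :
    (SemistarOperation.t D K).IsQuasiIdeal I := by
  refine ⟨h.1, ?_⟩
  rw [h.2]
  ext x
  exact SemistarOperation.algebraMap_mem_coeSubmodule.symm

theorem mainTheorem3 (D K : Type*) [CommRing D] [IsDomain D] [Field K] [Algebra D K]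
    [IsFractionRing D K] :
    (∀ star : SemistarOperation D K, star.IsPStarMD →
      ∀ I : Ideal D, star.finiteType.IsQuasiIdeal I →
        (star.finiteType.IsIdempotentIdeal I ↔
          I.IsRadical ∧ ∀ P ∈ I.minimalPrimes, star.finiteType.IsIdempotentIdeal P)) ∧
    (IsPvMD D K →
      ∀ I : Ideal D, IsTIdeal D K I →
        ((SemistarOperation.t D K).IsIdempotentIdeal I ↔
          I.IsRadical ∧
            ∀ P ∈ I.minimalPrimes, (SemistarOperation.t D K).IsIdempotentIdeal P)) :=
  ⟨fun _ hstar _ hI => hstar.invertsFGIdeals.isIdempotentIdeal_iff_isRadical hI,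
    fun hD _ hI => hD.invertsFGIdeals.isIdempotentIdeal_iff_isRadical hI.isQuasiIdeal⟩
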